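/- A quantum encryption of classical messages (QECM) with message set $\{0,\dots,M-1\}$, $M\ge 1$, and $d$-dimensional ciphertext space $A=\mathbb C^d$ consists of a probability distribution $P_K$ on a (measurable) key space, an encryption map assigning to each key $k$ and message $m$ a density operator $\mathrm{Enc}_k(m)$ on $A$, and for each key $k$ a decryption measurement (POVM) $\{D^k_m\}_m$ on $A$. It is perfectly correct if, for almost every key $k$ drawn from $P_K$ and all $m$, $\mathrm{tr}(D^k_m\,\mathrm{Enc}_k(m))=1$. A cloning attack consists of a quantum channel $\mathcal N_{A\to BC}$ (with $B,C$ finite-dimensional of arbitrary dimension) and, for every key $k$, POVMs $\{P^k_m\}_m$ on $B$ and $\{Q^k_m\}_m$ on $C$. The optimal success probability for uniform messages is $$p^*(\mathcal E)=\sup\ \frac1M\sum_{m}\mathbb E_{k\sim P_K}\,\mathrm{tr}\big((P^k_m\otimes Q^k_m)\,\mathcal N_{A\to BC}(\mathrm{Enc}_k(m))\big),$$ the supremum being over all cloning attacks. The ciphertext rank $r(\mathcal E)$ is the least integer $r$ such that for almost every key $k$ all ciphertexts $\mathrm{Enc}_k(0),\dots,\mathrm{Enc}_k(M-1)$ have rank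 at most $r$. **Theorem.** (i) There is an absolute constant $c>0.02285$ such that every perfectly correct QECM $\mathcal E$ with $M\ge1$ messages and $d$-dimensional ciphertexts satisfies $$p^*(\mathcal E)\ \ge\ c\,\frac{\log_2 M-1}{d}.$$ (ii) If the success probability is $O(1/M)$, then the ciphertext rank is $\Omega(\log M)$: for every $C>0$ there is $c'>0$, depending only on $C$, such that every perfectly correct QECM $\mathcal E$ with $M\ge1$ messages (and ciphertexts of any finite dimension) with $p^*(\mathcal E)\le C/M$ satisfies $r(\mathcal E)\ge c'\log_2 M$. -/

import Mathlib

open scoped Kronecker ComplexOrder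
open MeasureTheory

namespace UncloneableEncryption

/-- A density operator on the finite-dimensional Hilbert space `ℂ^a`: positive semidefinite with
unit trace. -/
structure IsDensity {a : Type*} [Fintype a] (ρ : Matrix a a ℂ) : Prop where
  posSemidef : ρ.PosSemidef
  trace_eq_one : ρ.trace = 1

/-- A positive operator-valued measure on `ℂ^a` with finite outcome set `X`. -/
structure IsPOVM {X a : Type*} [Fintype X] [Fintype a] [DecidableEq a]
    (P : X → Matrix a a ℂ) : Prop where
  posSemidef : ∀ x, (P x).PosSemidef
  sum_eq_one : ∑ x, P x = 1

/-- The ampliation `id_n ⊗ N` of a linear map `N : L(ℂ^a) → L(ℂ^b)`: an operator on `ℂ^n ⊗ ℂ^a` is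
an `n × n` array of blocks in `L(ℂ^a)`, and `N` is applied to every block. -/
def ampliation {a b : Type*} (n : ℕ) (N : Matrix a a ℂ →ₗ[ℂ] Matrix b b ℂ)
    (X : Matrix (Fin n × a) (Fin n × a) ℂ) : Matrix (Fin n × b) (Fin n × b) ℂ :=
  Matrix.of fun p q => N (Matrix.of fun i j => X (p.1, i) (q.1, j)) p.2 q.2

/-- A quantum channel from `L(ℂ^a)` to `L(ℂ^b)`: a linear map that is completely positive (every
ampliation preserves positivity) and trace preserving. -/
structure IsChannel {a b : Type*} [Fintype a] [Fintype b]
    (N : Matrix a a ℂ →ₗ[ℂ] Matrix b b ℂ) : Prop where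
  completelyPositive : ∀ (n : ℕ) (X : Matrix (Fin n × a) (Fin n × a) ℂ),
    X.PosSemidef → (ampliation n N X).PosSemidef
  trace_preserving : ∀ X, (N X).trace = X.trace

/-- A quantum encryption of classical messages with key space `K`, messages `{0, …, M - 1}` and
ciphertext space `ℂ^d`. Key generation samples `k` from the probability distribution `keyDist`,
encryption maps `(k, m)` to a density operator (depending measurably on `k`), and decryption with
the key `k` is a quantum measurement whose outcome is a message. -/
structure QECM (K : Type*) [MeasurableSpace K] (M d : ℕ) where
  keyDist : Measure K
  isProbabilityMeasure : IsProbabilityMeasure keyDist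
  enc : K → Fin M → Matrix (Fin d) (Fin d) ℂ
  enc_isDensity : ∀ k m, IsDensity (enc k m)
  enc_measurable : ∀ m i j, Measurable fun k => enc k m i j
  dec : K → Fin M → Matrix (Fin d) (Fin d) ℂ
  dec_isPOVM : ∀ k, IsPOVM (dec k)

/-- A cloning attack: a quantum channel `A → B ⊗ C` together with, for every key, a POVM of Bob
on `B` and a POVM of Charlie on `C` (depending measurably on the key). The dimensions of `B` and
`C` are arbitrary. -/
structure CloningAttack (K : Type*) [MeasurableSpace K] (M d : ℕ) where
  dimB : ℕ
  dimC : ℕ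
  channel : Matrix (Fin d) (Fin d) ℂ →ₗ[ℂ] Matrix (Fin dimB × Fin dimC) (Fin dimB × Fin dimC) ℂ
  channel_isChannel : IsChannel channel
  bob : K → Fin M → Matrix (Fin dimB) (Fin dimB) ℂ
  bob_isPOVM : ∀ k, IsPOVM (bob k)
  bob_measurable : ∀ m i j, Measurable fun k => bob k m i j
  charlie : K → Fin M → Matrix (Fin dimC) (Fin dimC) ℂ
  charlie_isPOVM : ∀ k, IsPOVM (charlie k)
  charlie_measurable : ∀ m i j, Measurable fun k => charlie k m i j

namespace QECM

variable {K : Type*} [MeasurableSpace K] {M d : ℕ}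

/-- The probability that decrypting the encryption of `m` under the key `k` returns `m`. -/
noncomputable def decryptProb (E : QECM K M d) (k : K) (m : Fin M) : ℝ :=
  (Matrix.trace (E.dec k m * E.enc k m)).re

/-- Perfect correctness: for (almost) every key produced by key generation, every message is
decrypted correctly with probability one. -/
def IsCorrect (E : QECM K M d) : Prop :=
  ∀ᵐ k ∂E.keyDist, ∀ m, E.decryptProb k m = 1

/-- The success probability of a cloning attack for uniformly distributed messages. -/
noncomputable def winProb (E : QECM K M d) (A : CloningAttack K M d) : ℝ :=
  (1 / (M : ℝ)) * ∑ m : Fin M,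
    ∫ k, (Matrix.trace ((A.bob k m ⊗ₖ A.charlie k m) * A.channel (E.enc k m))).re ∂E.keyDist

/-- The optimal success probability over all cloning attacks, for uniform messages. -/
noncomputable def optWinProb (E : QECM K M d) : ℝ :=
  ⨆ A : CloningAttack K M d, E.winProb A

/-- The ciphertext rank: the least `r` such that, for (almost) every key produced by key
generation, all ciphertexts have rank at most `r`. -/
noncomputable def ciphertextRank (E : QECM K M d) : ℕ :=
  sInf {r : ℕ | ∀ᵐ k ∂E.keyDist, ∀ m, (E.enc k m).rank ≤ r}

end QECM

end UncloneableEncryption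

/-!
Lower bounds on the success probability of cloning attacks against uncloneable encryption.

The attack measures the ciphertext in a random orthonormal basis, hands the outcome `j` to both
parties and, once the key is revealed, lets both announce the message `m` whose ciphertext `ρ m` has
the largest overlap `⟨x, ρ m x⟩` with the measured basis vector `x`. Both parties always agree, so
the success probability is `1 / M` times the average over the key of `∑ j, max m, ⟨x j, ρ m x j⟩`.
For a Haar-random basis the expectation of this sum is half of the expectation of
`max m, ⟨g, ρ m g⟩` for a standard complex Gaussian vector `g` (`lintegral_unitary_sum`). As the
success probability is averaged over the choice of the basis, some fixed basis does at least as well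
(`exists_orthonormalBasis_le_lintegral_sum`), and for it the attack is a channel with
finite-dimensional outputs.

Perfect correctness forces the eigenvectors with nonzero eigenvalues of all ciphertexts under one
key to form an orthonormal family (`orthonormal_eigenvectors`), and a state of rank at most `R` has
an eigenvalue at least `1 / R`. Hence `N` ciphertexts of rank at most `R` make the maximum at least
`1 / R` times the largest squared modulus of `N` independent standard complex Gaussians. This has
expectation at least `log N` (`log_card_le_lintegral_stdGaussian`), which gives a success
probability of at least `log N / (2 R M)`.

With all `N = M` ciphertexts and `R` the ciphertext rank this is the bound that involves the rank.
In dimension `d` the ranks under one key sum to at most `d`, so that at least `M / 2` of them are at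
most `2 d / M`; the resulting bound `log (M / 2) / (4 d)` is the one that involves the dimension,
with the constant `log 2 / 4 ≈ 0.173`.
-/

namespace UncloneableEncryption

open ProbabilityTheory ENNReal

/-! ### Complex Gaussian vectors -/

lemma stdGaussian_complex_eq_withDensity :
    stdGaussian ℂ = (volume : Measure ℂ).withDensity
      fun z => ENNReal.ofReal ((2 * Real.pi)⁻¹ * Real.exp (-(1 / 2) * ‖z‖ ^ 2)) := by
  have hint : Integrable fun z : ℂ => (2 * Real.pi)⁻¹ * Real.exp (-(1 / 2) * ‖z‖ ^ 2) := by
    refine Integrable.const_mul ?_ _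
    have := GaussianFourier.integrable_cexp_neg_mul_sq_norm_add (b := 1 / 2) (by norm_num) 0 (0 : ℂ)
    refine this.norm.congr (ae_of_all _ fun z => ?_)
    simp [Complex.norm_exp, ← Complex.ofReal_pow]
  have hfin : IsFiniteMeasure ((volume : Measure ℂ).withDensity
      fun z => ENNReal.ofReal ((2 * Real.pi)⁻¹ * Real.exp (-(1 / 2) * ‖z‖ ^ 2))) :=
    isFiniteMeasure_withDensity_ofReal hint.2
  -- both sides have the same characteristic function
  apply Measure.ext_of_charFun
  ext t
  rw [charFun_stdGaussian, charFun_apply,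
    integral_withDensity_eq_integral_toReal_smul (by fun_prop) (by simp)]
  have h := GaussianFourier.integral_cexp_neg_mul_sq_norm_add (b := 1 / 2) (by norm_num)
    Complex.I t
  have h2 : ∀ z : ℂ, (ENNReal.ofReal ((2 * Real.pi)⁻¹ * Real.exp (-(1 / 2) * ‖z‖ ^ 2))).toReal •
      Complex.exp (inner ℝ z t * Complex.I) =
      (2 * Real.pi : ℂ)⁻¹ *
        Complex.exp (-(1 / 2) * ‖z‖ ^ 2 + Complex.I * inner ℝ t z) := by
    intro z
    rw [ENNReal.toReal_ofReal (by positivity), Complex.exp_add, Complex.real_smul,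
      real_inner_comm]
    push_cast
    ring_nf
  simp_rw [h2]
  rw [integral_const_mul, h]
  have hpi : (Real.pi : ℂ) ≠ 0 := by exact_mod_cast Real.pi_ne_zero
  simp only [Complex.finrank_real_complex]
  norm_num
  field_simp

/-- The squared modulus of a standard complex Gaussian is exponentially distributed. -/
lemma stdGaussian_complex_real_norm_sq_ge {T : ℝ} (hT : 0 ≤ T) :
    (stdGaussian ℂ).real {z | T ≤ ‖z‖ ^ 2} = Real.exp (-T / 2) := by
  have hms : MeasurableSet {z : ℂ | T ≤ ‖z‖ ^ 2} := measurableSet_le (by fun_prop) (by fun_prop)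
  rw [stdGaussian_complex_eq_withDensity, measureReal_def, withDensity_apply _ hms,
    ← integral_toReal (by fun_prop) (by simp)]
  rw [← integral_indicator hms]
  have h1 : ∀ z : ℂ, ({z : ℂ | T ≤ ‖z‖ ^ 2}.indicator fun z =>
      (ENNReal.ofReal ((2 * Real.pi)⁻¹ * Real.exp (-(1 / 2) * ‖z‖ ^ 2))).toReal) z =
      (fun y : ℝ => if T ≤ y ^ 2 then (2 * Real.pi)⁻¹ * Real.exp (-(1 / 2) * y ^ 2) else 0)
        ‖z‖ := by
    intro z
    simp only [Set.indicator_apply, Set.mem_ofPred_eq]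
    split_ifs
    · rw [ENNReal.toReal_ofReal (by positivity)]
    · rfl
  simp_rw [h1]
  -- polar coordinates reduce the integral to the radial one, which has a primitive
  rw [integral_fun_norm_addHaar volume
    (fun y : ℝ => if T ≤ y ^ 2 then (2 * Real.pi)⁻¹ * Real.exp (-(1 / 2) * y ^ 2) else 0)]
  have h2 : ∀ y ∈ Set.Ioi (0 : ℝ), y ^ (Module.finrank ℝ ℂ - 1) •
      (if T ≤ y ^ 2 then (2 * Real.pi)⁻¹ * Real.exp (-(1 / 2) * y ^ 2) else 0) =
      (Set.Ici (Real.sqrt T)).indicator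
        (fun y => (2 * Real.pi)⁻¹ * (y * Real.exp (-(1 / 2) * y ^ 2))) y := by
    intro y hy
    rw [Set.mem_Ioi] at hy
    simp only [Set.indicator_apply, Set.mem_Ici, Real.sqrt_le_left hy.le,
      Complex.finrank_real_complex]
    split_ifs <;> (simp; try ring)
  rw [setIntegral_congr_fun measurableSet_Ioi h2, setIntegral_indicator measurableSet_Ici]
  have h3 : (Set.Ioi (0 : ℝ) ∩ Set.Ici (Real.sqrt T) : Set ℝ) =ᵐ[volume] Set.Ioi (Real.sqrt T) := by
    have : (Set.Ioi (0 : ℝ) ∩ Set.Ioi (Real.sqrt T) : Set ℝ) = Set.Ioi (Real.sqrt T) := by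
      rw [Set.Ioi_inter_Ioi, max_eq_right (Real.sqrt_nonneg T)]
    rw [← this]
    exact (ae_eq_refl _).inter Ioi_ae_eq_Ici.symm
  rw [setIntegral_congr_set h3, integral_const_mul]
  have h4 : ∫ y in Set.Ioi (Real.sqrt T), y * Real.exp (-(1 / 2) * y ^ 2) = Real.exp (-T / 2) := by
    have hd : ∀ y ∈ Set.Ici (Real.sqrt T), HasDerivAt (fun y : ℝ => -Real.exp (-(1 / 2) * y ^ 2))
        (y * Real.exp (-(1 / 2) * y ^ 2)) y := by
      intro y _
      have := (((hasDerivAt_pow 2 y).const_mul (-(1 / 2 : ℝ))).exp).neg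
      convert! this using 1
      simp; ring
    have hlim : Filter.Tendsto (fun y : ℝ => -Real.exp (-(1 / 2) * y ^ 2)) Filter.atTop
        (nhds 0) := by
      rw [← neg_zero]
      refine (Real.tendsto_exp_atBot.comp ?_).neg
      exact (Filter.tendsto_pow_atTop two_ne_zero).const_mul_atTop_of_neg (by norm_num)
    rw [integral_Ioi_of_hasDerivAt_of_nonneg' hd (fun y hy => ?_) hlim]
    · rw [Real.sq_sqrt hT]; simp; ring_nf
    · have : 0 ≤ y := (Real.sqrt_nonneg T).trans (Set.mem_Ioi.1 hy).le
      positivity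
  rw [h4]
  simp [measureReal_def, Complex.volume_ball]
  field_simp

lemma lintegral_norm_sq_stdGaussian_complex :
    ∫⁻ z, ENNReal.ofReal (‖z‖ ^ 2) ∂(stdGaussian ℂ) = 2 := by
  have hL (L : StrongDual ℝ ℂ) :
      Integrable (fun z => L z ^ 2) (stdGaussian ℂ) ∧ ∫ z, L z ^ 2 ∂(stdGaussian ℂ) = ‖L‖ ^ 2 := by
    have hm : MemLp L 2 (stdGaussian ℂ) := IsGaussian.memLp_dual _ L 2 (by simp)
    refine ⟨hm.integrable_sq, ?_⟩
    have := variance_eq_sub hm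
    rw [variance_dual_stdGaussian, integral_strongDual_stdGaussian] at this
    simpa using this.symm
  have h1 := hL Complex.reCLM
  have h2 := hL Complex.imCLM
  have h3 : ∀ z : ℂ, ‖z‖ ^ 2 = Complex.reCLM z ^ 2 + Complex.imCLM z ^ 2 := by
    intro z
    rw [Complex.sq_norm, Complex.normSq_apply, Complex.reCLM_apply, Complex.imCLM_apply]
    ring
  simp_rw [h3]
  rw [← ofReal_integral_eq_lintegral_ofReal
      (f := fun z => Complex.reCLM z ^ 2 + Complex.imCLM z ^ 2)
      (h1.1.add h2.1) (ae_of_all _ fun z => by positivity), integral_add h1.1 h2.1, h1.2, h2.2,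
    Complex.reCLM_norm, Complex.imCLM_norm]
  norm_num

section Gaussian

variable {ι : Type*} [Fintype ι]

lemma map_pi_eq_stdGaussian_complex :
    (Measure.pi fun _ : ι => stdGaussian ℂ).map (WithLp.toLp 2) =
      stdGaussian (EuclideanSpace ℂ ι) := by
  apply Measure.ext_of_charFun (E := EuclideanSpace ℂ ι)
  ext t
  simp_rw [charFun_stdGaussian, charFun_pi, charFun_stdGaussian, ← Complex.exp_sum,
    ← Complex.ofReal_pow, EuclideanSpace.norm_sq_eq]
  simp [Finset.sum_div, neg_div]

/-- A standard complex Gaussian vector is unitarily invariant. -/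
lemma stdGaussian_map_complex {κ : Type*} [Fintype κ]
    (e : EuclideanSpace ℂ ι ≃ₗᵢ[ℂ] EuclideanSpace ℂ κ) :
    (stdGaussian (EuclideanSpace ℂ ι)).map e = stdGaussian (EuclideanSpace ℂ κ) := by
  let e' : EuclideanSpace ℂ ι ≃ₗᵢ[ℝ] EuclideanSpace ℂ κ :=
    { toLinearEquiv := e.toLinearEquiv.restrictScalars ℝ
      norm_map' := e.norm_map }
  exact stdGaussian_map e'

lemma lintegral_norm_sq_stdGaussian :
    ∫⁻ x, ENNReal.ofReal (‖x‖ ^ 2) ∂(stdGaussian (EuclideanSpace ℂ ι)) =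
      2 * Fintype.card ι := by
  rw [← map_pi_eq_stdGaussian_complex, lintegral_map (by fun_prop) (by fun_prop)]
  simp_rw [EuclideanSpace.norm_sq_eq, ENNReal.ofReal_sum_of_nonneg (fun _ _ => sq_nonneg _)]
  rw [lintegral_finsetSum _ (by fun_prop)]
  have h (i : ι) : ∫⁻ x : ι → ℂ, ENNReal.ofReal (‖x i‖ ^ 2) ∂(Measure.pi fun _ => stdGaussian ℂ) =
      2 := by
    rw [← lintegral_norm_sq_stdGaussian_complex,
      ← (measurePreserving_eval (fun _ : ι => stdGaussian ℂ) i).lintegral_comp (by fun_prop)]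
  simp_rw [h]
  simp [mul_comm]

/-- The largest squared modulus among `N` coordinates of a complex Gaussian vector has expectation
at least `log N`: it exceeds `2 log N` with probability `1 - (1 - 1 / N) ^ N ≥ 1 / 2`. -/
lemma log_card_le_lintegral_stdGaussian (S : Finset ι) (hS : S.Nonempty)
    (F : EuclideanSpace ℂ ι → ℝ≥0∞) (hF : ∀ x, ∀ i ∈ S, ENNReal.ofReal (‖x i‖ ^ 2) ≤ F x) :
    ENNReal.ofReal (Real.log S.card) ≤ ∫⁻ x, F x ∂(stdGaussian (EuclideanSpace ℂ ι)) := by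
  classical
  have hN : (1 : ℝ) ≤ S.card := by exact_mod_cast hS.card_pos
  set T : ℝ := 2 * Real.log S.card with hTdef
  have hT : 0 ≤ T := mul_nonneg two_pos.le (Real.log_nonneg hN)
  have hcoord : MeasurableSet {z : ℂ | T ≤ ‖z‖ ^ 2} :=
    measurableSet_le (by fun_prop) (by fun_prop)
  set A : Set (ι → ℂ) := Set.univ.pi fun i => if i ∈ S then {z : ℂ | T ≤ ‖z‖ ^ 2}ᶜ else Set.univ
    with hA
  have hAm : MeasurableSet A := by
    refine MeasurableSet.univ_pi fun i => ?_
    split_ifs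
    · exact hcoord.compl
    · exact MeasurableSet.univ
  set P := Measure.pi fun _ : ι => stdGaussian ℂ with hP
  have hPA : P.real A ≤ 1 / 2 := by
    have h1 : P.real A = (1 - 1 / (S.card : ℝ)) ^ S.card := by
      rw [measureReal_def, hA, hP, Measure.pi_pi, ENNReal.toReal_prod]
      have : ∀ i : ι, ((stdGaussian ℂ) (if i ∈ S then {z : ℂ | T ≤ ‖z‖ ^ 2}ᶜ else Set.univ)).toReal
          = if i ∈ S then 1 - 1 / (S.card : ℝ) else 1 := by
        intro i
        split_ifs
        · rw [← measureReal_def, probReal_compl_eq_one_sub hcoord,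
            stdGaussian_complex_real_norm_sq_ge hT, hTdef]
          rw [show -(2 * Real.log S.card) / 2 = -Real.log S.card by ring, Real.exp_neg,
            Real.exp_log (by linarith), one_div]
        · simp
      simp_rw [this]
      rw [Finset.prod_ite]
      simp
    rw [h1]
    refine (Real.one_sub_div_pow_le_exp_neg hN).trans ?_
    have := Real.exp_one_gt_d9
    rw [Real.exp_neg, inv_eq_one_div]
    exact one_div_le_one_div_of_le two_pos (by linarith)
  have hPAc : ENNReal.ofReal (1 / 2) ≤ P Aᶜ := by
    rw [← ofReal_measureReal (μ := P), probReal_compl_eq_one_sub hAm]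
    exact ENNReal.ofReal_le_ofReal (by linarith)
  have hemb : MeasurableEmbedding (WithLp.toLp 2 : (ι → ℂ) → EuclideanSpace ℂ ι) :=
    (MeasurableEquiv.toLp 2 (ι → ℂ)).measurableEmbedding
  rw [← map_pi_eq_stdGaussian_complex, hemb.lintegral_map]
  calc ENNReal.ofReal (Real.log S.card) = ENNReal.ofReal T * ENNReal.ofReal (1 / 2) := by
        rw [← ENNReal.ofReal_mul hT, hTdef]; congr 1; ring
    _ ≤ ENNReal.ofReal T * P Aᶜ := by gcongr
    _ = ∫⁻ _ in Aᶜ, ENNReal.ofReal T ∂P := by rw [setLIntegral_const]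
    _ ≤ ∫⁻ x in Aᶜ, F (WithLp.toLp 2 x) ∂P := by
        refine setLIntegral_mono' hAm.compl fun x hx => ?_
        simp only [hA, Set.mem_compl_iff, Set.mem_univ_pi, not_forall] at hx
        obtain ⟨i, hi⟩ := hx
        by_cases hiS : i ∈ S
        · simp only [hiS, if_true, Set.mem_compl_iff, not_not, Set.mem_ofPred_eq] at hi
          exact (ENNReal.ofReal_le_ofReal hi).trans (hF (WithLp.toLp 2 x) i hiS)
        · simp [hiS] at hi
    _ ≤ ∫⁻ x, F (WithLp.toLp 2 x) ∂P := setLIntegral_le_lintegral _ _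

end Gaussian

/-! ### Random orthonormal bases -/

section Haar

variable {E : Type*} [NormedAddCommGroup E] [InnerProductSpace ℂ E] [CompleteSpace E]

lemma unitary_inv_apply_eq (V U : unitary (E →L[ℂ] E)) (x : E) :
    (U⁻¹).1 x = ((V * U)⁻¹).1 (V.1 x) := by
  conv_lhs => rw [show U⁻¹ = (V * U)⁻¹ * V by group]
  rfl

lemma measurable_unitary_inv_apply_const [MeasurableSpace E] [BorelSpace E] (x : E) :
    Measurable fun U : unitary (E →L[ℂ] E) => (U⁻¹).1 x := by
  have h : Continuous fun U : unitary (E →L[ℂ] E) => (U⁻¹).1 :=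
    continuous_subtype_val.comp continuous_inv
  exact (h.clm_apply continuous_const).measurable

variable [FiniteDimensional ℂ E]

lemma compactSpace_unitary : CompactSpace (unitary (E →L[ℂ] E)) := by
  have : ProperSpace (E →L[ℂ] E) := FiniteDimensional.proper ℂ _
  have hcl : IsClosed (unitary (E →L[ℂ] E) : Set (E →L[ℂ] E)) := isClosed_unitary
  refine isCompact_iff_compactSpace.1 (Metric.isCompact_of_isClosed_isBounded hcl ?_)
  refine (Metric.isBounded_iff_subset_closedBall 0).2 ⟨1, fun U hU => ?_⟩
  rw [mem_closedBall_zero_iff]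
  refine ContinuousLinearMap.opNorm_le_bound _ zero_le_one fun x => ?_
  rw [ContinuousLinearMap.norm_map_of_mem_unitary hU, one_mul]

/-- The unitary group acts transitively on vectors of a given norm. -/
lemma exists_unitary_apply_eq {x y : E} (hx : ‖x‖ = 1) (hy : ‖y‖ = 1) :
    ∃ V : unitary (E →L[ℂ] E), (V : E →L[ℂ] E) x = y := by
  have hcard : Module.finrank ℂ E = Fintype.card (Fin (Module.finrank ℂ E)) := by simp
  have hpos : 0 < Module.finrank ℂ E := by
    have : Nontrivial E := ⟨x, 0, fun h => by simp [h] at hx⟩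
    exact Module.finrank_pos
  have key : ∀ z : E, ‖z‖ = 1 → ∃ b : OrthonormalBasis (Fin (Module.finrank ℂ E)) ℂ E,
      b ⟨0, hpos⟩ = z := by
    intro z hz
    obtain ⟨b, hb⟩ := Orthonormal.exists_orthonormalBasis_extension_of_card_eq hcard
      (v := fun _ => z) (s := {⟨0, hpos⟩}) ⟨fun _ => hz, fun i j hij =>
        absurd (Subsingleton.elim i j) hij⟩
    exact ⟨b, hb _ rfl⟩
  obtain ⟨b, hb⟩ := key x hx
  obtain ⟨b', hb'⟩ := key y hy
  refine ⟨Unitary.linearIsometryEquiv.symm (b.equiv b' (Equiv.refl _)), ?_⟩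
  rw [← hb, ← hb']
  simp

variable [MeasurableSpace E] [BorelSpace E]

lemma measurable_unitary_inv_apply :
    Measurable fun p : unitary (E →L[ℂ] E) × E => (p.1⁻¹).1 p.2 := by
  have : ProperSpace E := FiniteDimensional.proper ℂ E
  have h : Continuous fun p : unitary (E →L[ℂ] E) × E => (p.1⁻¹).1 :=
    continuous_subtype_val.comp (continuous_inv.comp continuous_fst)
  exact (h.clm_apply continuous_snd).measurable

variable {ι : Type*} [Fintype ι]

/-- Summing a function that is homogeneous of degree two over a random orthonormal basis gives, on
average, half of its expectation on a unitarily invariant random vector of expected squared length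
`2 d`: the mean of the function over the unitary orbit of a vector is proportional to the squared
length of the vector, and an orthonormal basis has total squared length `d`. The basis is moved by
`U⁻¹` because only left invariance of `ν` is available. -/
lemma lintegral_unitary_sum (ν : Measure (unitary (E →L[ℂ] E))) [IsProbabilityMeasure ν]
    [ν.IsMulLeftInvariant] (b : OrthonormalBasis ι ℂ E) (γ : Measure E) [IsProbabilityMeasure γ]
    (hγ : ∀ e : E ≃ₗᵢ[ℂ] E, γ.map e = γ)
    (hγ_sq : ∫⁻ x, ENNReal.ofReal (‖x‖ ^ 2) ∂γ = 2 * Fintype.card ι)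
    (f : E → ℝ≥0∞) (hf : Measurable f)
    (hhom : ∀ (c : ℝ) x, f ((c : ℂ) • x) = ENNReal.ofReal (c ^ 2) * f x) :
    2 * ∫⁻ U : unitary (E →L[ℂ] E), ∑ j, f ((U⁻¹).1 (b j)) ∂ν = ∫⁻ x, f x ∂γ := by
  obtain ⟨h, hh⟩ : ∃ h : E → ℝ≥0∞, ∀ x, h x = ∫⁻ U : unitary (E →L[ℂ] E), f ((U⁻¹).1 x) ∂ν :=
    ⟨_, fun _ => rfl⟩
  have hjoint : Measurable fun p : unitary (E →L[ℂ] E) × E => f ((p.1⁻¹).1 p.2) :=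
    hf.comp measurable_unitary_inv_apply
  have hmeas (x : E) : Measurable fun U : unitary (E →L[ℂ] E) => f ((U⁻¹).1 x) :=
    hf.comp (measurable_unitary_inv_apply_const x)
  -- `h` averages `f` over the unitary orbit of its argument
  have hinv (V : unitary (E →L[ℂ] E)) (x : E) : h (V.1 x) = h x := by
    rw [hh (V.1 x), hh x, ← lintegral_mul_left_eq_self (fun U => f ((U⁻¹).1 (V.1 x))) V]
    exact lintegral_congr fun U => congrArg f (unitary_inv_apply_eq V U x).symm
  have hsmul (c : ℝ) (x : E) : h ((c : ℂ) • x) = ENNReal.ofReal (c ^ 2) * h x := by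
    simp only [hh, map_smul, hhom]
    rw [lintegral_const_mul _ (hmeas x)]
  have hzero : h 0 = 0 := by
    have := hsmul 0 0
    rw [smul_zero] at this
    rw [this]
    simp
  have hsphere (x : E) (j : ι) : h x = ENNReal.ofReal (‖x‖ ^ 2) * h (b j) := by
    by_cases hx : x = 0
    · simp [hx, hzero]
    · have hx' : (‖x‖ : ℂ) ≠ 0 := by simpa using hx
      obtain ⟨V, hV⟩ := exists_unitary_apply_eq (x := b j)
        (y := ((‖x‖ : ℂ)⁻¹ • x)) (by simp) (by rw [norm_smul]; simp [hx])
      have h1 : x = (‖x‖ : ℂ) • (V.1 (b j)) := by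
        rw [hV, smul_inv_smul₀ hx']
      conv_lhs => rw [h1]
      rw [hsmul, hinv]
  have hgauss : ∫⁻ x, h x ∂γ = ∫⁻ x, f x ∂γ := by
    simp only [hh]
    rw [lintegral_lintegral_swap (f := fun x (U : unitary (E →L[ℂ] E)) => f ((U⁻¹).1 x))
      (hjoint.comp measurable_swap).aemeasurable]
    have h1 (U : unitary (E →L[ℂ] E)) : ∫⁻ x, f ((U⁻¹).1 x) ∂γ = ∫⁻ x, f x ∂γ := by
      let e : E ≃ₗᵢ[ℂ] E := Unitary.linearIsometryEquiv U⁻¹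
      conv_rhs => rw [← hγ e, lintegral_map hf e.continuous.measurable]
      rfl
    simp [h1]
  have hsum : ∫⁻ U : unitary (E →L[ℂ] E), ∑ j, f ((U⁻¹).1 (b j)) ∂ν = ∑ j, h (b j) :=
    by
    rw [lintegral_finsetSum _ fun j _ => hmeas _]
    simp_rw [hh]
  rw [hsum, ← hgauss]
  rcases isEmpty_or_nonempty ι with hι | ⟨⟨i⟩⟩
  · have hz : ∀ x : E, x = 0 := fun x => by simpa using (b.sum_repr x).symm
    have hh0 : ∀ x : E, h x = 0 := fun x => by rw [hz x, hzero]
    simp [hh0]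
  · have hc (j : ι) : h (b j) = h (b i) := by simpa using hsphere (b j) i
    rw [lintegral_congr (hsphere · i), Finset.sum_congr rfl fun j _ => hc j,
      lintegral_mul_const _ (by fun_prop), hγ_sq]
    simp [mul_assoc]

/-- A single orthonormal basis performs at least as well as the average over all of them,
simultaneously for a family of functions averaged over a parameter `k`. -/
theorem exists_orthonormalBasis_le_lintegral_sum (b₀ : OrthonormalBasis ι ℂ E) (γ : Measure E)
    [IsProbabilityMeasure γ] (hγ : ∀ e : E ≃ₗᵢ[ℂ] E, γ.map e = γ)
    (hγ_sq : ∫⁻ x, ENNReal.ofReal (‖x‖ ^ 2) ∂γ = 2 * Fintype.card ι)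
    {K : Type*} [MeasurableSpace K] (μ : Measure K) [IsProbabilityMeasure μ]
    (f : K → E → ℝ≥0∞) (hf : Measurable fun p : K × E => f p.1 p.2)
    (hhom : ∀ k (c : ℝ) x, f k ((c : ℂ) • x) = ENNReal.ofReal (c ^ 2) * f k x)
    {L : ℝ≥0∞} (hL : L ≠ ∞) (hLf : ∀ᵐ k ∂μ, L ≤ ∫⁻ x, f k x ∂γ) :
    ∃ b : OrthonormalBasis ι ℂ E, L ≤ 2 * ∫⁻ k, ∑ j, f k (b j) ∂μ := by
  have := compactSpace_unitary (E := E)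
  let ν : Measure (unitary (E →L[ℂ] E)) := Measure.haarMeasure ⊤
  have hν : IsProbabilityMeasure ν := ⟨Measure.haarMeasure_self⟩
  have : ProperSpace E := FiniteDimensional.proper ℂ E
  set Φ : unitary (E →L[ℂ] E) → ℝ≥0∞ := fun U => 2 * ∫⁻ k, ∑ j, f k ((U⁻¹).1 (b₀ j)) ∂μ with hΦ
  have hm (j : ι) : Measurable fun p : K × unitary (E →L[ℂ] E) => f p.1 ((p.2⁻¹).1 (b₀ j)) :=
    hf.comp (measurable_fst.prodMk
      ((measurable_unitary_inv_apply_const (b₀ j)).comp measurable_snd))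
  have hm' : Measurable fun p : K × unitary (E →L[ℂ] E) => ∑ j, f p.1 ((p.2⁻¹).1 (b₀ j)) :=
    Finset.measurable_sum _ fun j _ => hm j
  have havg : L ≤ ∫⁻ U, Φ U ∂ν := by
    calc L = ∫⁻ _, L ∂μ := by simp
      _ ≤ ∫⁻ k, ∫⁻ x, f k x ∂γ ∂μ := lintegral_mono_ae hLf
      _ = ∫⁻ k, 2 * ∫⁻ U : unitary (E →L[ℂ] E), ∑ j, f k ((U⁻¹).1 (b₀ j)) ∂ν ∂μ := by
          refine lintegral_congr fun k => ?_
          rw [lintegral_unitary_sum ν b₀ γ hγ hγ_sq (f k) (hf.comp measurable_prodMk_left)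
            (hhom k)]
      _ = 2 * ∫⁻ k, ∫⁻ U : unitary (E →L[ℂ] E), ∑ j, f k ((U⁻¹).1 (b₀ j)) ∂ν ∂μ :=
          lintegral_const_mul _ hm'.lintegral_prod_right'
      _ = 2 * ∫⁻ U : unitary (E →L[ℂ] E), ∫⁻ k, ∑ j, f k ((U⁻¹).1 (b₀ j)) ∂μ ∂ν := by
          rw [lintegral_lintegral_swap hm'.aemeasurable]
      _ = ∫⁻ U, Φ U ∂ν := (lintegral_const_mul _ hm'.lintegral_prod_left').symm
  obtain ⟨U, hU⟩ : ∃ U, L ≤ Φ U := by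
    by_contra! hlt
    -- under the contrary assumption the average is finite, so some value of `Φ` reaches it
    have hle : ∫⁻ U, Φ U ∂ν ≤ L := by
      calc ∫⁻ U, Φ U ∂ν ≤ ∫⁻ _, L ∂ν := lintegral_mono fun U => (hlt U).le
        _ = L := by simp
    obtain ⟨U, hU⟩ := exists_lintegral_le (ne_top_of_le_ne_top hL hle)
    exact absurd (havg.trans hU) (hlt U).not_ge
  exact ⟨b₀.map (Unitary.linearIsometryEquiv U⁻¹), hU⟩

end Haar

/-! ### Eigenvectors of perfectly distinguishable states -/

open Matrix

section Eigenvectors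

variable {a : Type*} [Fintype a] [DecidableEq a]

lemma dotProduct_mulVec_eq_sum_eigenvalues {A : Matrix a a ℂ} (hA : A.IsHermitian)
    (x : EuclideanSpace ℂ a) :
    (star x.ofLp ⬝ᵥ A *ᵥ x.ofLp).re =
      ∑ i, hA.eigenvalues i * ‖inner ℂ (hA.eigenvectorBasis i) x‖ ^ 2 := by
  have h1 : star x.ofLp ⬝ᵥ A *ᵥ x.ofLp = inner ℂ x (WithLp.toLp 2 (A *ᵥ x.ofLp)) := by
    rw [EuclideanSpace.inner_eq_star_dotProduct, dotProduct_comm]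
  have h2 (i : a) : inner ℂ (hA.eigenvectorBasis i) (WithLp.toLp 2 (A *ᵥ x.ofLp)) =
      hA.eigenvalues i * inner ℂ (hA.eigenvectorBasis i) x := by
    rw [EuclideanSpace.inner_eq_star_dotProduct, EuclideanSpace.inner_eq_star_dotProduct]
    simp only
    have h3 (v : a → ℂ) : star v ᵥ* A = star (A *ᵥ v) := by rw [star_mulVec, hA.eq]
    rw [dotProduct_comm, dotProduct_mulVec, h3, hA.mulVec_eigenvectorBasis, dotProduct_comm]
    simp
  rw [h1, ← hA.eigenvectorBasis.sum_inner_mul_inner, Complex.re_sum]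
  refine Finset.sum_congr rfl fun i _ => ?_
  rw [h2, mul_left_comm, ← inner_conj_symm, ← Complex.normSq_eq_conj_mul_self,
    Complex.normSq_eq_norm_sq]
  norm_cast

lemma trace_mul_eq_sum_eigenvalues {A : Matrix a a ℂ} (hA : A.IsHermitian) (D : Matrix a a ℂ) :
    (D * A).trace = ∑ i, (hA.eigenvalues i : ℂ) *
      (star (hA.eigenvectorBasis i).ofLp ⬝ᵥ D *ᵥ (hA.eigenvectorBasis i).ofLp) := by
  have h : (D * A).trace = LinearMap.trace ℂ _ (Matrix.toEuclideanLin (D * A)) := by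
    rw [Matrix.toEuclideanLin_eq_toLin_orthonormal, Matrix.trace_toLin_eq]
  rw [h, LinearMap.trace_eq_sum_inner _ hA.eigenvectorBasis]
  refine Finset.sum_congr rfl fun i _ => ?_
  rw [EuclideanSpace.inner_eq_star_dotProduct, Matrix.toLpLin_apply]
  simp only
  rw [← mulVec_mulVec, hA.mulVec_eigenvectorBasis, dotProduct_comm]
  simp [mulVec_smul]

/-- A positive operator dominated by the identity that is certain to occur on a state fixes every
eigenvector of that state with nonzero eigenvalue. -/
lemma mulVec_eigenvectorBasis_eq_self {ρ D : Matrix a a ℂ} (hρ : IsDensity ρ)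
    (hD : (1 - D).PosSemidef) (hDρ : (D * ρ).trace.re = 1) {i : a}
    (hi : hρ.posSemidef.isHermitian.eigenvalues i ≠ 0) :
    D *ᵥ (hρ.posSemidef.isHermitian.eigenvectorBasis i).ofLp =
      (hρ.posSemidef.isHermitian.eigenvectorBasis i).ofLp := by
  set hA := hρ.posSemidef.isHermitian
  have h1 : ((1 - D) * ρ).trace.re = 0 := by
    rw [sub_mul, one_mul, trace_sub, Complex.sub_re, hDρ, hρ.trace_eq_one]
    simp
  rw [trace_mul_eq_sum_eigenvalues hA, Complex.re_sum] at h1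
  have hnn (j : a) := hD.dotProduct_mulVec_nonneg (hA.eigenvectorBasis j).ofLp
  have h2 := (Finset.sum_eq_zero_iff_of_nonneg fun j _ => by
    rw [Complex.re_ofReal_mul]
    exact mul_nonneg (hρ.posSemidef.eigenvalues_nonneg j) (Complex.nonneg_iff.1 (hnn j)).1).1 h1
    i (Finset.mem_univ i)
  rw [Complex.re_ofReal_mul] at h2
  have h3 : star (hA.eigenvectorBasis i).ofLp ⬝ᵥ (1 - D) *ᵥ (hA.eigenvectorBasis i).ofLp = 0 :=
    Complex.ext ((mul_eq_zero.1 h2).resolve_left hi) (Complex.nonneg_iff.1 (hnn i)).2.symm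
  have h4 := (hD.dotProduct_mulVec_zero_iff _).1 h3
  rw [sub_mulVec, one_mulVec, sub_eq_zero] at h4
  exact h4.symm

/-- The eigenvalues of a density operator sum to one and only `rank ρ` of them are nonzero. -/
lemma exists_one_le_rank_mul_eigenvalue {ρ : Matrix a a ℂ} (hρ : IsDensity ρ) :
    ∃ i, 1 ≤ ρ.rank * hρ.posSemidef.isHermitian.eigenvalues i := by
  set hA := hρ.posSemidef.isHermitian
  by_contra! hlt
  have htr : ∑ i, hA.eigenvalues i = 1 := by
    have := hA.trace_eq_sum_eigenvalues
    rw [hρ.trace_eq_one] at this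
    have h := congrArg Complex.re this
    simpa using h.symm
  have htr' : ∑ i : {i // hA.eigenvalues i ≠ 0}, hA.eigenvalues i = 1 := by
    refine Eq.trans ?_ ((Finset.sum_filter_ne_zero Finset.univ).trans htr)
    exact (Finset.sum_subtype (p := fun i => hA.eigenvalues i ≠ 0)
      (Finset.univ.filter fun i => hA.eigenvalues i ≠ 0) (by simp) hA.eigenvalues).symm
  have hrank : (ρ.rank : ℝ) = Fintype.card {i // hA.eigenvalues i ≠ 0} := by
    rw [hA.rank_eq_card_non_zero_eigs]
  have hne : Nonempty {i // hA.eigenvalues i ≠ 0} := by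
    by_contra hempty
    rw [not_nonempty_iff] at hempty
    simp at htr'
  have h2 : ∑ i : {i // hA.eigenvalues i ≠ 0}, ρ.rank * hA.eigenvalues i <
      ∑ _i : {i // hA.eigenvalues i ≠ 0}, (1 : ℝ) :=
    Finset.sum_lt_sum_of_nonempty Finset.univ_nonempty fun i _ => hlt i
  rw [← Finset.mul_sum, htr', hrank] at h2
  simp at h2

variable {X : Type*} [Fintype X]

lemma IsPOVM.one_sub_posSemidef {D : X → Matrix a a ℂ} (hD : IsPOVM D) (m : X) :
    (1 - D m).PosSemidef := by
  classical
  rw [← hD.sum_eq_one, ← Finset.add_sum_erase _ _ (Finset.mem_univ m), add_sub_cancel_left]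
  exact posSemidef_sum _ fun x _ => hD.posSemidef x

/-- Eigenvectors, for nonzero eigenvalues, of all members of a family of density operators that is
perfectly distinguished by a measurement form an orthonormal family. -/
lemma orthonormal_eigenvectors {ρ D : X → Matrix a a ℂ} (hρ : ∀ m, IsDensity (ρ m))
    (hD : IsPOVM D) (hDρ : ∀ m, (D m * ρ m).trace.re = 1) :
    Orthonormal ℂ fun p : Σ m, {i // (hρ m).posSemidef.isHermitian.eigenvalues i ≠ 0} =>
      (hρ p.1).posSemidef.isHermitian.eigenvectorBasis p.2 := by
  classical
  have hfix (m : X) (i : {i // (hρ m).posSemidef.isHermitian.eigenvalues i ≠ 0}) :=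
    mulVec_eigenvectorBasis_eq_self (hρ m) (hD.one_sub_posSemidef m) (hDρ m) i.2
  -- a vector fixed by one element of a POVM is annihilated by all others
  have hker {m m' : X} (hm : m ≠ m') {v : a → ℂ} (hv : D m *ᵥ v = v) : D m' *ᵥ v = 0 := by
    have h1 : ∑ x ∈ Finset.univ.erase m, star v ⬝ᵥ D x *ᵥ v = 0 := by
      have h2 : ∑ x, star v ⬝ᵥ D x *ᵥ v = star v ⬝ᵥ v := by
        rw [← dotProduct_sum, ← sum_mulVec, hD.sum_eq_one, one_mulVec]
      rw [← Finset.add_sum_erase _ _ (Finset.mem_univ m), hv] at h2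
      simpa using h2
    have h3 := (Finset.sum_eq_zero_iff_of_nonneg fun x _ =>
      (hD.posSemidef x).dotProduct_mulVec_nonneg v).1 h1 m' (by simp [hm.symm])
    exact ((hD.posSemidef m').dotProduct_mulVec_zero_iff v).1 h3
  refine ⟨fun p => by simp, ?_⟩
  rintro ⟨m, i⟩ ⟨m', i'⟩ hne
  by_cases hm : m = m'
  · subst hm
    refine ((hρ m).posSemidef.isHermitian.eigenvectorBasis.orthonormal).2 fun h => hne ?_
    have h' : i = i' := Subtype.ext h
    rw [h']
  · have h1 := hker hm (hfix m i)
    simp only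
    rw [EuclideanSpace.inner_eq_star_dotProduct, ← hfix m' i', ← (hD.posSemidef m').1.eq,
      dotProduct_comm, dotProduct_mulVec, vecMul_conjTranspose, star_star, h1]
    simp

lemma sum_rank_le_card {ρ D : X → Matrix a a ℂ} (hρ : ∀ m, IsDensity (ρ m))
    (hD : IsPOVM D) (hDρ : ∀ m, (D m * ρ m).trace.re = 1) :
    ∑ m, (ρ m).rank ≤ Fintype.card a := by
  have h := (orthonormal_eigenvectors hρ hD hDρ).linearIndependent.fintype_card_le_finrank
  rw [Fintype.card_sigma, finrank_euclideanSpace] at h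
  simpa only [(hρ _).posSemidef.isHermitian.rank_eq_card_non_zero_eigs] using h

/-- The expectation of the largest overlap between a complex Gaussian vector and a family of
perfectly distinguishable states, many of which have small rank: each of the latter has an
eigenvalue at least `1 / R`, the corresponding eigenvectors are orthonormal, and the components of
the Gaussian vector along them are independent. -/
lemma log_card_div_le_lintegral_iSup {ρ D : X → Matrix a a ℂ} (hρ : ∀ m, IsDensity (ρ m))
    (hD : IsPOVM D) (hDρ : ∀ m, (D m * ρ m).trace.re = 1) (S : Finset X) (hS : S.Nonempty)
    {R : ℝ} (hR : 0 < R) (hrank : ∀ m ∈ S, ((ρ m).rank : ℝ) ≤ R) :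
    ENNReal.ofReal (Real.log S.card / R) ≤
      ∫⁻ x, ⨆ m, ENNReal.ofReal (star x.ofLp ⬝ᵥ ρ m *ᵥ x.ofLp).re
        ∂(stdGaussian (EuclideanSpace ℂ a)) := by
  classical
  choose i hi using fun m => exists_one_le_rank_mul_eigenvalue (hρ m)
  have hi0 (m : X) : (hρ m).posSemidef.isHermitian.eigenvalues (i m) ≠ 0 := by
    intro h
    have := hi m
    rw [h] at this
    simp at this
    linarith
  set w : X → EuclideanSpace ℂ a := fun m =>
    (hρ m).posSemidef.isHermitian.eigenvectorBasis (i m) with hw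
  have hwo : Orthonormal ℂ w :=
    (orthonormal_eigenvectors hρ hD hDρ).comp (fun m => ⟨m, i m, hi0 m⟩) fun m m' h =>
      congrArg Sigma.fst h
  have hwinj : Function.Injective w := hwo.linearIndependent.injective
  obtain ⟨u, b, hu, hb⟩ := hwo.toSubtypeRange.exists_orthonormalBasis_extension
  have hmem (m : X) : w m ∈ u := hu ⟨m, rfl⟩
  let g : X ↪ u := ⟨fun m => ⟨w m, hmem m⟩, fun m m' h => hwinj (congrArg Subtype.val h)⟩
  set F : EuclideanSpace ℂ a → ℝ≥0∞ := fun x =>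
    ⨆ m, ENNReal.ofReal (star x.ofLp ⬝ᵥ ρ m *ᵥ x.ofLp).re with hF
  have hlow (x : EuclideanSpace ℂ a) (m : X) (hm : m ∈ S) :
      ENNReal.ofReal (‖inner ℂ (w m) x‖ ^ 2) ≤ ENNReal.ofReal R * F x := by
    calc ENNReal.ofReal (‖inner ℂ (w m) x‖ ^ 2)
        ≤ ENNReal.ofReal (R * (star x.ofLp ⬝ᵥ ρ m *ᵥ x.ofLp).re) := by
          refine ENNReal.ofReal_le_ofReal ?_
          rw [dotProduct_mulVec_eq_sum_eigenvalues (hρ m).posSemidef.isHermitian]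
          have hev := (hρ m).posSemidef.eigenvalues_nonneg
          have h1 := Finset.single_le_sum (f := fun j =>
            (hρ m).posSemidef.isHermitian.eigenvalues j *
              ‖inner ℂ ((hρ m).posSemidef.isHermitian.eigenvectorBasis j) x‖ ^ 2)
            (fun j _ => mul_nonneg (hev j) (sq_nonneg _)) (Finset.mem_univ (i m))
          have h2 : 1 ≤ R * (hρ m).posSemidef.isHermitian.eigenvalues (i m) :=
            (hi m).trans (mul_le_mul_of_nonneg_right (hrank m hm) (hev _))
          refine le_trans ?_ (mul_le_mul_of_nonneg_left h1 hR.le)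
          rw [← mul_assoc]
          exact le_mul_of_one_le_left (sq_nonneg _) h2
      _ = ENNReal.ofReal R * ENNReal.ofReal (star x.ofLp ⬝ᵥ ρ m *ᵥ x.ofLp).re :=
          ENNReal.ofReal_mul hR.le
      _ ≤ ENNReal.ofReal R * F x := by
          gcongr
          exact le_iSup (fun m => ENNReal.ofReal (star x.ofLp ⬝ᵥ ρ m *ᵥ x.ofLp).re) m
  have hFm : Measurable F := by
    refine Measurable.iSup fun m => ?_
    refine (Continuous.measurable ?_).ennreal_ofReal
    fun_prop
  -- in coordinates with respect to `b`, the overlaps with `w m` are coordinates of the vector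
  have hlog := log_card_le_lintegral_stdGaussian (S.map g) (hS.map)
    (fun y => ENNReal.ofReal R * F (b.repr.symm y)) (by
      intro y j hj
      obtain ⟨m, hm, rfl⟩ := Finset.mem_map.1 hj
      have h1 : y (g m) = inner ℂ (w m) (b.repr.symm y) := by
        have h2 := b.repr_apply_apply (b.repr.symm y) (g m)
        rw [LinearIsometryEquiv.apply_symm_apply, hb] at h2
        exact h2
      rw [h1]
      exact hlow _ m hm)
  rw [Finset.card_map, lintegral_const_mul (f := fun y => F (b.repr.symm y)) _
    (hFm.comp b.repr.symm.continuous.measurable),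
    ← lintegral_map hFm b.repr.symm.continuous.measurable,
    stdGaussian_map_complex b.repr.symm] at hlog
  rw [ENNReal.ofReal_div_of_pos hR]
  exact ENNReal.div_le_of_le_mul' hlog

end Eigenvectors

/-! ### Boundedness of the success probability -/

section Bounded

variable {a b : Type*} [Fintype a] [Fintype b]

open scoped MatrixOrder Matrix.Norms.L2Operator in
lemma trace_mul_nonneg_of_posSemidef {P Q : Matrix a a ℂ} (hP : P.PosSemidef)
    (hQ : Q.PosSemidef) : 0 ≤ (P * Q).trace := by
  classical
  obtain ⟨B, rfl⟩ := CStarAlgebra.nonneg_iff_eq_star_mul_self.mp hP.nonneg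
  rw [mul_assoc, trace_mul_comm, star_eq_conjTranspose]
  exact (hQ.mul_mul_conjTranspose_same B).trace_nonneg

lemma IsChannel.posSemidef_map {N : Matrix a a ℂ →ₗ[ℂ] Matrix b b ℂ} (hN : IsChannel N)
    {X : Matrix a a ℂ} (hX : X.PosSemidef) : (N X).PosSemidef := by
  have h := hN.completelyPositive 1 (X.submatrix Prod.snd Prod.snd) (hX.submatrix _)
  exact h.submatrix fun i => ((0 : Fin 1), i)

lemma re_trace_kronecker_mul_mem_Icc [DecidableEq a] [DecidableEq b] {P : Matrix a a ℂ}
    {Q : Matrix b b ℂ} {σ : Matrix (a × b) (a × b) ℂ} (hP : P.PosSemidef)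
    (hP' : (1 - P).PosSemidef) (hQ : Q.PosSemidef) (hQ' : (1 - Q).PosSemidef)
    (hσ : σ.PosSemidef) (hσ' : σ.trace = 1) :
    ((P ⊗ₖ Q) * σ).trace.re ∈ Set.Icc (0 : ℝ) 1 := by
  refine ⟨(Complex.nonneg_iff.1 (trace_mul_nonneg_of_posSemidef (hP.kronecker hQ) hσ)).1, ?_⟩
  have h1 : (1 - P ⊗ₖ Q).PosSemidef := by
    have h2 : 1 - P ⊗ₖ Q = (1 - P) ⊗ₖ (1 : Matrix b b ℂ) + P ⊗ₖ (1 - Q) := by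
      have h3 : (1 - P) ⊗ₖ (1 : Matrix b b ℂ) + P ⊗ₖ 1 = 1 := by
        rw [← add_kronecker, sub_add_cancel, one_kronecker_one]
      have h4 : P ⊗ₖ (1 - Q) + P ⊗ₖ Q = P ⊗ₖ 1 := by
        rw [← kronecker_add, sub_add_cancel]
      rw [← h3, ← h4]
      abel
    rw [h2]
    exact (hP'.kronecker PosSemidef.one).add (hP.kronecker hQ')
  have h3 := (Complex.nonneg_iff.1 (trace_mul_nonneg_of_posSemidef h1 hσ)).1
  rw [sub_mul, one_mul, trace_sub, hσ', Complex.sub_re, Complex.one_re] at h3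
  linarith

end Bounded

variable {K : Type*} [MeasurableSpace K] {M d : ℕ}

namespace QECM

lemma winProb_mem_Icc (E : QECM K M d) (A : CloningAttack K M d) :
    E.winProb A ∈ Set.Icc (0 : ℝ) 1 := by
  have := E.isProbabilityMeasure
  have hmem (k : K) (m : Fin M) :
      (Matrix.trace ((A.bob k m ⊗ₖ A.charlie k m) * A.channel (E.enc k m))).re ∈
        Set.Icc (0 : ℝ) 1 :=
    re_trace_kronecker_mul_mem_Icc ((A.bob_isPOVM k).posSemidef m)
      ((A.bob_isPOVM k).one_sub_posSemidef m) ((A.charlie_isPOVM k).posSemidef m)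
      ((A.charlie_isPOVM k).one_sub_posSemidef m)
      (A.channel_isChannel.posSemidef_map (E.enc_isDensity k m).posSemidef)
      (by rw [A.channel_isChannel.trace_preserving, (E.enc_isDensity k m).trace_eq_one])
  have hint (m : Fin M) : ∫ k, (Matrix.trace ((A.bob k m ⊗ₖ A.charlie k m) *
      A.channel (E.enc k m))).re ∂E.keyDist ≤ 1 := by
    calc _ ≤ ∫ _, (1 : ℝ) ∂E.keyDist :=
          integral_mono_of_nonneg (ae_of_all _ fun k => (hmem k m).1) (integrable_const _)
            (ae_of_all _ fun k => (hmem k m).2)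
      _ = 1 := by simp
  refine ⟨mul_nonneg (by positivity) (Finset.sum_nonneg fun m _ =>
    integral_nonneg fun k => (hmem k m).1), ?_⟩
  calc E.winProb A ≤ 1 / (M : ℝ) * ∑ _m : Fin M, 1 :=
        mul_le_mul_of_nonneg_left (Finset.sum_le_sum fun m _ => hint m) (by positivity)
    _ ≤ 1 := by
        rw [Finset.sum_const, Finset.card_univ, Fintype.card_fin, nsmul_eq_mul, mul_one,
          one_div]
        exact inv_mul_le_one

lemma winProb_le_optWinProb (E : QECM K M d) (A : CloningAttack K M d) :
    E.winProb A ≤ E.optWinProb :=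
  le_ciSup (f := E.winProb) ⟨1, by rintro _ ⟨A, rfl⟩; exact (E.winProb_mem_Icc A).2⟩ A

end QECM

/-! ### Measure-and-guess attacks -/

lemma exists_measurable_argmax {α : Type*} [MeasurableSpace α] (hM : 0 < M)
    (g : Fin M → α → ℝ) (hg : ∀ m, Measurable (g m)) :
    ∃ s : α → Fin M, Measurable s ∧ ∀ x m, g m x ≤ g (s x) x := by
  have : Nonempty (Fin M) := ⟨⟨0, hM⟩⟩
  have hne (x : α) : (Finset.univ.filter fun m => ∀ m', g m' x ≤ g m x).Nonempty := by
    obtain ⟨m, hm⟩ := Finite.exists_max fun m => g m x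
    exact ⟨m, by simpa using hm⟩
  -- ties are broken in favour of the least index, which keeps the choice measurable
  refine ⟨fun x => (Finset.univ.filter fun m => ∀ m', g m' x ≤ g m x).min' (hne x), ?_, ?_⟩
  · have hA (m : Fin M) : MeasurableSet {x | ∀ m', g m' x ≤ g m x} := by
      rw [Set.ofPred_forall]
      exact MeasurableSet.iInter fun m' => measurableSet_le (hg m') (hg m)
    refine measurable_to_countable' fun m => ?_
    have h : (fun x => (Finset.univ.filter fun m => ∀ m', g m' x ≤ g m x).min' (hne x)) ⁻¹' {m} =
        {x | ∀ m', g m' x ≤ g m x} ∩ ⋂ m'' : Fin M, ⋂ _ : m'' < m,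
          {x | ∀ m', g m' x ≤ g m'' x}ᶜ := by
      ext x
      simp only [Set.mem_preimage, Set.mem_singleton_iff, Finset.min'_eq_iff, Finset.mem_filter,
        Finset.mem_univ, true_and, Set.mem_inter_iff, Set.mem_iInter, Set.mem_compl_iff,
        Set.mem_ofPred_eq]
      refine and_congr_right fun _ => forall_congr' fun m'' => ?_
      rw [← not_lt, not_imp_not.symm, not_not]
    rw [h]
    exact (hA m).inter
      (MeasurableSet.iInter fun m'' => MeasurableSet.iInter fun _ => (hA m'').compl)
  · intro x m
    have h := Finset.min'_mem _ (hne x)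
    simp only [Finset.mem_filter, Finset.mem_univ, true_and] at h
    exact h m

/-- Measurement in an orthonormal basis, with the outcome `j` handed to both parties as the state
`|j⟩⟨j| ⊗ |j⟩⟨j|`. -/
noncomputable def basisChannel (b : OrthonormalBasis (Fin d) ℂ (EuclideanSpace ℂ (Fin d))) :
    Matrix (Fin d) (Fin d) ℂ →ₗ[ℂ] Matrix (Fin d × Fin d) (Fin d × Fin d) ℂ where
  toFun X := diagonal fun p =>
    if p.1 = p.2 then star (b p.1).ofLp ⬝ᵥ X *ᵥ (b p.1).ofLp else 0
  map_add' X Y := by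
    rw [diagonal_add]
    congr 1
    ext p
    split_ifs <;> simp [add_mulVec]
  map_smul' c X := by
    rw [RingHom.id_apply, ← diagonal_smul]
    congr 1
    ext p
    simp [smul_mulVec]

lemma sum_dotProduct_mulVec_eq_trace (b : OrthonormalBasis (Fin d) ℂ (EuclideanSpace ℂ (Fin d)))
    (X : Matrix (Fin d) (Fin d) ℂ) :
    ∑ j, star (b j).ofLp ⬝ᵥ X *ᵥ (b j).ofLp = X.trace := by
  have h : X.trace = LinearMap.trace ℂ _ (Matrix.toEuclideanLin X) := by
    rw [Matrix.toEuclideanLin_eq_toLin_orthonormal, Matrix.trace_toLin_eq]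
  rw [h, LinearMap.trace_eq_sum_inner _ b]
  refine Finset.sum_congr rfl fun i _ => ?_
  rw [EuclideanSpace.inner_eq_star_dotProduct, Matrix.toLpLin_apply, dotProduct_comm]

lemma basisChannel_isChannel (b : OrthonormalBasis (Fin d) ℂ (EuclideanSpace ℂ (Fin d))) :
    IsChannel (basisChannel b) where
  completelyPositive n X hX := by
    -- `Y j` is the unnormalized state of the reference system conditioned on the outcome `j`
    let W (j : Fin d) : Matrix (Fin n × Fin d) (Fin n) ℂ :=
      Matrix.of fun p s => if p.1 = s then b j p.2 else 0
    let Y (j : Fin d) : Matrix (Fin n) (Fin n) ℂ := (W j)ᴴ * X * W j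
    have hY (j : Fin d) : (Y j).PosSemidef := hX.conjTranspose_mul_mul_same (W j)
    have hYapp (j : Fin d) (r s : Fin n) : Y j r s =
        star (b j).ofLp ⬝ᵥ (Matrix.of fun i l => X (r, i) (s, l)) *ᵥ (b j).ofLp := by
      simp only [Y, W, mul_apply, conjTranspose_apply, of_apply, Fintype.sum_prod_type,
        dotProduct, mulVec, Pi.star_apply, Finset.sum_mul, Finset.mul_sum]
      rw [Finset.sum_eq_single s (by intro x _ hx; simp [hx]) (by simp)]
      conv_rhs => rw [Finset.sum_comm]
      refine Finset.sum_congr rfl fun l _ => ?_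
      rw [Finset.sum_eq_single r (by intro x _ hx; simp [hx]) (by simp)]
      refine Finset.sum_congr rfl fun i _ => ?_
      simp [mul_assoc]
    have hdec : ampliation n (basisChannel b) X =
        ∑ j, Y j ⊗ₖ diagonal fun q : Fin d × Fin d => if q = (j, j) then (1 : ℂ) else 0 := by
      ext ⟨r, p⟩ ⟨s, q⟩
      rw [Matrix.sum_apply]
      simp only [ampliation, basisChannel, of_apply, LinearMap.coe_mk, AddHom.coe_mk,
        kronecker_apply, diagonal_apply, hYapp]
      rcases p with ⟨p₁, p₂⟩
      by_cases hpq : (p₁, p₂) = q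
      · subst hpq
        by_cases hp : p₁ = p₂
        · subst hp
          simp
        · simp only [if_true, hp, if_false, Prod.mk.injEq]
          symm
          refine Finset.sum_eq_zero fun j _ => ?_
          rw [if_neg (fun h => hp (h.1.trans h.2.symm)), mul_zero]
      · simp [hpq]
    rw [hdec]
    refine posSemidef_sum _ fun j _ => (hY j).kronecker (PosSemidef.diagonal fun q => ?_)
    simp only [Pi.zero_apply]
    split_ifs <;> simp
  trace_preserving X := by
    rw [← sum_dotProduct_mulVec_eq_trace b X]
    simp [basisChannel, trace_diagonal, Fintype.sum_prod_type]

lemma isPOVM_diagonal_guess (s : Fin d → Fin M) :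
    IsPOVM fun m => diagonal fun j => if s j = m then (1 : ℂ) else 0 where
  posSemidef m := PosSemidef.diagonal fun j => by
    simp only [Pi.zero_apply]
    split_ifs <;> simp
  sum_eq_one := by
    ext i j
    rw [Matrix.sum_apply]
    by_cases hij : i = j
    · subst hij; simp
    · simp [hij]

/-- The attack that measures the ciphertext in an orthonormal basis, hands the outcome `j` to both
parties, and lets both of them announce the message `s k j` once the key `k` is revealed. -/
noncomputable def basisAttack (b : OrthonormalBasis (Fin d) ℂ (EuclideanSpace ℂ (Fin d)))
    (s : K → Fin d → Fin M) (hs : ∀ j, Measurable fun k => s k j) : CloningAttack K M d where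
  dimB := d
  dimC := d
  channel := basisChannel b
  channel_isChannel := basisChannel_isChannel b
  bob k m := diagonal fun j => if s k j = m then 1 else 0
  bob_isPOVM k := isPOVM_diagonal_guess (s k)
  bob_measurable m i j := by
    simp only [diagonal_apply]
    split_ifs
    · exact Measurable.ite (hs i (measurableSet_singleton m)) measurable_const measurable_const
    · exact measurable_const
  charlie k m := diagonal fun j => if s k j = m then 1 else 0
  charlie_isPOVM k := isPOVM_diagonal_guess (s k)
  charlie_measurable m i j := by
    simp only [diagonal_apply]
    split_ifs
    · exact Measurable.ite (hs i (measurableSet_singleton m)) measurable_const measurable_const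
    · exact measurable_const

lemma re_trace_basisAttack (E : QECM K M d)
    (b : OrthonormalBasis (Fin d) ℂ (EuclideanSpace ℂ (Fin d)))
    (s : K → Fin d → Fin M) (hs : ∀ j, Measurable fun k => s k j) (k : K) (m : Fin M) :
    (Matrix.trace (((basisAttack b s hs).bob k m ⊗ₖ (basisAttack b s hs).charlie k m) *
      (basisAttack b s hs).channel (E.enc k m))).re =
      ∑ j, if s k j = m then (star (b j).ofLp ⬝ᵥ E.enc k m *ᵥ (b j).ofLp).re else 0 := by
  have h : ((diagonal fun j => if s k j = m then (1 : ℂ) else 0) ⊗ₖ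
      (diagonal fun j => if s k j = m then (1 : ℂ) else 0) * basisChannel b (E.enc k m)).trace.re =
      ∑ j, if s k j = m then (star (b j).ofLp ⬝ᵥ E.enc k m *ᵥ (b j).ofLp).re else 0 := by
    simp only [basisChannel, LinearMap.coe_mk, AddHom.coe_mk]
    rw [diagonal_kronecker_diagonal, diagonal_mul_diagonal, trace_diagonal, Complex.re_sum,
      Fintype.sum_prod_type]
    refine Finset.sum_congr rfl fun j _ => ?_
    rw [Finset.sum_eq_single j (by intro l _ hl; simp [hl.symm]) (by simp)]
    by_cases h : s k j = m <;> simp [h]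
  exact h

lemma measurable_re_dotProduct_mulVec {α : Type*} [MeasurableSpace α]
    {A : α → Matrix (Fin d) (Fin d) ℂ} {v : α → EuclideanSpace ℂ (Fin d)}
    (hA : ∀ i j, Measurable fun x => A x i j) (hv : Measurable v) :
    Measurable fun x => (star (v x).ofLp ⬝ᵥ A x *ᵥ (v x).ofLp).re := by
  have hv' (i : Fin d) : Measurable fun x => (v x).ofLp i := by fun_prop
  simp only [dotProduct, mulVec, Pi.star_apply]
  refine Complex.measurable_re.comp (Finset.measurable_sum _ fun i _ => Measurable.mul ?_ ?_)
  · exact (continuous_star.measurable).comp (hv' i)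
  · exact Finset.measurable_sum _ fun j _ => (hA i j).mul (hv' j)

/-- Both parties guess a message that maximizes the overlap of its ciphertext with the measured
basis vector. -/
lemma le_optWinProb_of_orthonormalBasis (E : QECM K M d) (hM : 0 < M)
    (b : OrthonormalBasis (Fin d) ℂ (EuclideanSpace ℂ (Fin d))) {c : ℝ}
    (hc : ENNReal.ofReal c ≤ ∫⁻ k, ∑ j, ⨆ m,
      ENNReal.ofReal (star (b j).ofLp ⬝ᵥ E.enc k m *ᵥ (b j).ofLp).re ∂E.keyDist) :
    c / M ≤ E.optWinProb := by
  have := E.isProbabilityMeasure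
  have hov (m : Fin M) (j : Fin d) :
      Measurable fun k => (star (b j).ofLp ⬝ᵥ E.enc k m *ᵥ (b j).ofLp).re :=
    measurable_re_dotProduct_mulVec (v := fun _ => b j) (E.enc_measurable m) measurable_const
  choose s hs hmax using fun j => exists_measurable_argmax hM _ (fun m => hov m j)
  have hov0 (k : K) (m : Fin M) (j : Fin d) :
      0 ≤ (star (b j).ofLp ⬝ᵥ E.enc k m *ᵥ (b j).ofLp).re :=
    (E.enc_isDensity k m).posSemidef.re_dotProduct_nonneg _
  have hov1 (k : K) (m : Fin M) (j : Fin d) :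
      (star (b j).ofLp ⬝ᵥ E.enc k m *ᵥ (b j).ofLp).re ≤ 1 := by
    have h := congrArg Complex.re (sum_dotProduct_mulVec_eq_trace b (E.enc k m))
    rw [(E.enc_isDensity k m).trace_eq_one, Complex.re_sum, Complex.one_re] at h
    rw [← h]
    exact Finset.single_le_sum (f := fun j => (star (b j).ofLp ⬝ᵥ E.enc k m *ᵥ (b j).ofLp).re)
      (fun j _ => hov0 k m j) (Finset.mem_univ j)
  set t : Fin M → Fin d → K → ℝ := fun m j k =>
    if s j k = m then (star (b j).ofLp ⬝ᵥ E.enc k m *ᵥ (b j).ofLp).re else 0 with ht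
  have htm (m : Fin M) (j : Fin d) : Measurable (t m j) :=
    Measurable.ite (hs j (measurableSet_singleton m)) (hov m j) measurable_const
  have ht0 (m : Fin M) (j : Fin d) (k : K) : 0 ≤ t m j k := by
    simp only [ht]; split_ifs
    exacts [hov0 k m j, le_rfl]
  have ht1 (m : Fin M) (j : Fin d) (k : K) : t m j k ≤ 1 := by
    simp only [ht]; split_ifs
    exacts [hov1 k m j, zero_le_one]
  have hti (m : Fin M) (j : Fin d) : Integrable (t m j) E.keyDist :=
    Integrable.of_bound (htm m j).aestronglyMeasurable 1 (ae_of_all _ fun k => by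
      rw [Real.norm_of_nonneg (ht0 m j k)]; exact ht1 m j k)
  have hwin : E.winProb (basisAttack b (fun k j => s j k) hs) =
      (1 / (M : ℝ)) * ∫ k, ∑ m, ∑ j, t m j k ∂E.keyDist := by
    rw [QECM.winProb, integral_finsetSum _ fun m _ => integrable_finsetSum _ fun j _ => hti m j]
    simp_rw [re_trace_basisAttack]
    rfl
  refine le_trans ?_ (E.winProb_le_optWinProb (basisAttack b (fun k j => s j k) hs))
  rw [hwin, one_div, div_eq_inv_mul]
  refine mul_le_mul_of_nonneg_left ?_ (by positivity)
  have hnn : 0 ≤ ∫ k, ∑ m, ∑ j, t m j k ∂E.keyDist :=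
    integral_nonneg fun k => Finset.sum_nonneg fun m _ => Finset.sum_nonneg fun j _ => ht0 m j k
  rw [← ENNReal.ofReal_le_ofReal_iff hnn, ofReal_integral_eq_lintegral_ofReal
    (integrable_finsetSum _ fun m _ => integrable_finsetSum _ fun j _ => hti m j)
    (ae_of_all _ fun k => Finset.sum_nonneg fun m _ => Finset.sum_nonneg fun j _ => ht0 m j k)]
  refine hc.trans (lintegral_mono fun k => ?_)
  have hsum : ∑ m, ∑ j, t m j k =
      ∑ j, (star (b j).ofLp ⬝ᵥ E.enc k (s j k) *ᵥ (b j).ofLp).re := by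
    rw [Finset.sum_comm]
    refine Finset.sum_congr rfl fun j _ => ?_
    simp [ht]
  simp only
  rw [hsum, ENNReal.ofReal_sum_of_nonneg fun j _ => hov0 k _ j]
  exact Finset.sum_le_sum fun j _ => iSup_le fun m => ENNReal.ofReal_le_ofReal (hmax j k m)

/-- Averaging over all bases replaces the sum over the measured basis by a Gaussian expectation. -/
lemma le_optWinProb_of_lintegral_stdGaussian (E : QECM K M d) (hM : 0 < M) {c : ℝ}
    (hc : ∀ᵐ k ∂E.keyDist, ENNReal.ofReal c ≤
      ∫⁻ x, ⨆ m, ENNReal.ofReal (star x.ofLp ⬝ᵥ E.enc k m *ᵥ x.ofLp).re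
        ∂(stdGaussian (EuclideanSpace ℂ (Fin d)))) :
    c / (2 * M) ≤ E.optWinProb := by
  have := E.isProbabilityMeasure
  obtain ⟨b, hb⟩ := exists_orthonormalBasis_le_lintegral_sum (EuclideanSpace.basisFun (Fin d) ℂ)
    (stdGaussian (EuclideanSpace ℂ (Fin d))) stdGaussian_map_complex lintegral_norm_sq_stdGaussian
    E.keyDist
    (fun k x => ⨆ m, ENNReal.ofReal (star x.ofLp ⬝ᵥ E.enc k m *ᵥ x.ofLp).re)
    (Measurable.iSup fun m => (measurable_re_dotProduct_mulVec
      (A := fun p : K × EuclideanSpace ℂ (Fin d) => E.enc p.1 m)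
      (fun i j => (E.enc_measurable m i j).comp measurable_fst) measurable_snd).ennreal_ofReal)
    (fun k c x => by
      rw [ENNReal.mul_iSup]
      refine iSup_congr fun m => ?_
      rw [← ENNReal.ofReal_mul (sq_nonneg c)]
      congr 1
      simp [mulVec_smul, ← mul_assoc, sq])
    ENNReal.ofReal_ne_top hc
  have h := le_optWinProb_of_orthonormalBasis E hM b (c := c / 2) (by
    rw [ENNReal.ofReal_div_of_pos two_pos]
    refine ENNReal.div_le_of_le_mul' ?_
    simpa using hb)
  rwa [div_div] at h

/-! ### Lower bounds on the success probability -/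

namespace QECM

lemma dim_pos (E : QECM K M d) (hM : 0 < M) : 0 < d := by
  have := E.isProbabilityMeasure
  obtain ⟨k⟩ := nonempty_of_isProbabilityMeasure E.keyDist
  obtain ⟨i, _⟩ := exists_one_le_rank_mul_eigenvalue (E.enc_isDensity k ⟨0, hM⟩)
  exact i.pos

/-- At least half of a family of perfectly distinguishable states have rank at most twice the
average available dimension `d / M`. -/
lemma half_le_card_rank_le {ρ D : Fin M → Matrix (Fin d) (Fin d) ℂ} (hM : 0 < M) (hd : 0 < d)
    (hρ : ∀ m, IsDensity (ρ m)) (hD : IsPOVM D) (hDρ : ∀ m, (D m * ρ m).trace.re = 1) :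
    (M : ℝ) / 2 ≤ (Finset.univ.filter fun m => ((ρ m).rank : ℝ) ≤ 2 * d / M).card := by
  have hM' : (0 : ℝ) < M := by exact_mod_cast hM
  have hd' : (0 : ℝ) < d := by exact_mod_cast hd
  have hsum : ∑ m, ((ρ m).rank : ℝ) ≤ d := by
    have h := sum_rank_le_card hρ hD hDρ
    rw [Fintype.card_fin] at h
    exact_mod_cast h
  have hcard := Finset.card_filter_add_card_filter_not (s := (Finset.univ : Finset (Fin M)))
    (fun m => ((ρ m).rank : ℝ) ≤ 2 * d / M)
  rw [Finset.card_univ, Fintype.card_fin] at hcard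
  have hcard' : ((Finset.univ.filter fun m => ((ρ m).rank : ℝ) ≤ 2 * d / M).card : ℝ) +
      (Finset.univ.filter fun m => ¬((ρ m).rank : ℝ) ≤ 2 * d / M).card = M := by
    exact_mod_cast hcard
  have hlarge : ((Finset.univ.filter fun m => ¬((ρ m).rank : ℝ) ≤ 2 * d / M).card : ℝ) *
      (2 * d / M) ≤ d := by
    calc _ = ∑ _m ∈ Finset.univ.filter fun m => ¬((ρ m).rank : ℝ) ≤ 2 * d / M, (2 * d / M : ℝ) := by
          rw [Finset.sum_const, nsmul_eq_mul]
      _ ≤ ∑ m ∈ Finset.univ.filter fun m => ¬((ρ m).rank : ℝ) ≤ 2 * d / M, ((ρ m).rank : ℝ) :=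
          Finset.sum_le_sum fun m hm => (not_le.1 (Finset.mem_filter.1 hm).2).le
      _ ≤ ∑ m, ((ρ m).rank : ℝ) :=
          Finset.sum_le_sum_of_subset_of_nonneg (Finset.filter_subset _ _)
            fun m _ _ => Nat.cast_nonneg _
      _ ≤ d := hsum
  have h2 : ((Finset.univ.filter fun m => ¬((ρ m).rank : ℝ) ≤ 2 * d / M).card : ℝ) ≤ M / 2 := by
    rw [← le_div_iff₀ (by positivity)] at hlarge
    refine hlarge.trans_eq ?_
    field_simp
  linarith

theorem log_div_dim_le_optWinProb (E : QECM K M d) (hM : 0 < M) (hE : E.IsCorrect) :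
    Real.log (M / 2) / (4 * d) ≤ E.optWinProb := by
  have hd := E.dim_pos hM
  have hM' : (0 : ℝ) < M := by exact_mod_cast hM
  have hd' : (0 : ℝ) < d := by exact_mod_cast hd
  have hR : (0 : ℝ) < 2 * d / M := by positivity
  have h := le_optWinProb_of_lintegral_stdGaussian E hM (c := Real.log (M / 2) / (2 * d / M)) (by
    filter_upwards [hE] with k hk
    have hhalf := half_le_card_rank_le hM hd (E.enc_isDensity k) (E.dec_isPOVM k) hk
    have hpos : (0 : ℝ) < M / 2 := by positivity
    refine le_trans (ENNReal.ofReal_le_ofReal ?_) (log_card_div_le_lintegral_iSup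
      (E.enc_isDensity k) (E.dec_isPOVM k) hk
      (Finset.univ.filter fun m => ((E.enc k m).rank : ℝ) ≤ 2 * d / M) ?_ hR ?_)
    · exact div_le_div_of_nonneg_right (Real.log_le_log hpos hhalf) hR.le
    · rw [← Finset.card_pos]
      exact_mod_cast hpos.trans_le hhalf
    · intro m hm
      exact (Finset.mem_filter.1 hm).2)
  refine le_trans (le_of_eq ?_) h
  field_simp
  ring

lemma ae_rank_le_ciphertextRank (E : QECM K M d) :
    ∀ᵐ k ∂E.keyDist, ∀ m, (E.enc k m).rank ≤ E.ciphertextRank :=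
  Nat.sInf_mem (s := {r : ℕ | ∀ᵐ k ∂E.keyDist, ∀ m, (E.enc k m).rank ≤ r})
    ⟨d, ae_of_all _ fun k m => by simpa using (E.enc k m).rank_le_width⟩

lemma ciphertextRank_pos (E : QECM K M d) (hM : 0 < M) : 0 < E.ciphertextRank := by
  have := E.isProbabilityMeasure
  obtain ⟨k, hk⟩ := E.ae_rank_le_ciphertextRank.exists
  obtain ⟨i, hi⟩ := exists_one_le_rank_mul_eigenvalue (E.enc_isDensity k ⟨0, hM⟩)
  refine lt_of_lt_of_le (Nat.pos_of_ne_zero fun h0 => ?_) (hk ⟨0, hM⟩)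
  rw [h0] at hi
  norm_num at hi

theorem log_div_ciphertextRank_le_optWinProb (E : QECM K M d) (hM : 0 < M) (hE : E.IsCorrect) :
    Real.log M / E.ciphertextRank / (2 * M) ≤ E.optWinProb := by
  refine le_optWinProb_of_lintegral_stdGaussian E hM ?_
  have hr : (0 : ℝ) < E.ciphertextRank := by exact_mod_cast E.ciphertextRank_pos hM
  filter_upwards [hE, E.ae_rank_le_ciphertextRank] with k hk hrk
  have h := log_card_div_le_lintegral_iSup (E.enc_isDensity k) (E.dec_isPOVM k) hk Finset.univ
    ⟨⟨0, hM⟩, Finset.mem_univ _⟩ hr (fun m _ => by exact_mod_cast hrk m)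
  rwa [Finset.card_univ, Fintype.card_fin] at h

end QECM

end UncloneableEncryption

theorem mainTheorem1 :
    (∃ c : ℝ, 0.02285 < c ∧
      ∀ (K : Type*) [MeasurableSpace K] (M d : ℕ) (E : UncloneableEncryption.QECM K M d),
        1 ≤ M → E.IsCorrect → c * (Real.logb 2 M - 1) / d ≤ E.optWinProb) ∧
    (∀ C : ℝ, 0 < C → ∃ c' : ℝ, 0 < c' ∧
      ∀ (K : Type*) [MeasurableSpace K] (M d : ℕ) (E : UncloneableEncryption.QECM K M d),
        1 ≤ M → E.IsCorrect → E.optWinProb ≤ C / M →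
          c' * Real.logb 2 M ≤ E.ciphertextRank) := by
  have hlog2 : 0 < Real.log 2 := Real.log_pos one_lt_two
  refine ⟨⟨Real.log 2 / 4, ?_, fun K _ M d E hM hE => ?_⟩,
    fun C hC => ⟨Real.log 2 / (2 * C), by positivity, fun K _ M d E hM hE hp => ?_⟩⟩
  · have := Real.log_two_gt_d9
    norm_num at this ⊢
    linarith
  · have hM' : (0 : ℝ) < M := by exact_mod_cast hM
    refine le_trans (le_of_eq ?_) (E.log_div_dim_le_optWinProb hM hE)
    rw [Real.log_div hM'.ne' two_ne_zero, Real.logb]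
    field_simp
  · have hM' : (0 : ℝ) < M := by exact_mod_cast hM
    have hr : (0 : ℝ) < E.ciphertextRank := by exact_mod_cast E.ciphertextRank_pos hM
    have h := (E.log_div_ciphertextRank_le_optWinProb hM hE).trans hp
    rw [div_div, div_le_div_iff₀ (by positivity) hM'] at h
    have h2 : Real.log M ≤ 2 * C * E.ciphertextRank := by
      refine le_of_mul_le_mul_right (h.trans_eq ?_) hM'
      ring
    rw [Real.logb, div_mul_div_comm, mul_comm (2 * C), mul_div_mul_left _ _ hlog2.ne',
      div_le_iff₀ (by positivity)]
    linarith
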